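/- Let $(M,h)$ be a closed Riemannian spin manifold of arbitrary dimension with Levi-Civita connection $\nabla$, and let $\Sigma M$ be its spinor bundle with its hermitian metric $\langle\cdot,\cdot\rangle$ (complex linear in the second argument), Clifford multiplication and spin connection $\nabla^{\Sigma M}$. More generally, $M$ may be any closed Riemannian manifold and $\Sigma M$ any Dirac bundle over it, that is, a complex vector bundle of finite rank with a smooth hermitian metric, a smooth Clifford multiplication satisfying $\langle\psi,X\cdot\eta\rangle=-\langle X\cdot\psi,\eta\rangle$ and $X\cdot Y\cdot\psi+Y\cdot X\cdot\psi=-2h(X,Y)\psi$, and a smooth hermitian connection satisfying $\nabla^{\Sigma M}_Y(X\cdot\psi)=(\nabla_YX)\cdot\psi+X\cdot\nabla^{\Sigma M}_Y\psi$. Let $D=\sum_\alpha e_\alpha\cdot\nabla^{\Sigma M}_{e_\alpha}$ be the Dirac operator, where $(e_\alpha)$ denotes an orthonormal basis of $T_xM$, and let $\Delta=\operatorname{div}\operatorname{grad}$. Let $n\ge 0$, let $\kappa\in\mathbb{R}$, and let $(\phi,\psi)$ be a smooth $\kappa$-Dirac-harmonic map from $M$ to the round unit sphere $S^n\subset\mathbb{R}^{n+1}$.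 That is, $\phi=(\phi^1,\dots,\phi^{n+1})\colon M\to S^n$ is a smooth map, $\psi=(\psi^1,\dots,\psi^{n+1})$ is a smooth section of $\Sigma M\otimes\phi^\ast TS^n\subset\Sigma M\otimes\mathbb{R}^{n+1}$ (so the $\psi^i$ are smooth sections of $\Sigma M$ with $\sum_i\phi^i\psi^i=0$), and, with $\phi^j_\alpha=d\phi^j(e_\alpha)$, for all $i=1,\dots,n+1$, $$-\Delta\phi^i=|d\phi|^2\phi^i+\sum_{\alpha,j}\operatorname{Re}\langle\psi^i,e_\alpha\cdot\psi^j\rangle\,\phi^j_\alpha,$$ $$D\psi^i=-\sum_{\alpha,j}\phi^j_\alpha\,\phi^i\,e_\alpha\cdot\psi^j-2\kappa\Big(|\psi|^2\psi^i-\sum_j\langle\psi^j,\psi^i\rangle\psi^j\Big),\qquad |\psi|^2=\sum_j|\psi^j|^2 .$$ Then for all $i,m\in\{1,\dots,n+1\}$ the vector field $J^{im}=\sum_\alpha J^{im}_\alpha e_\alpha$ on $M$ with $$J_\alpha^{im}=\operatorname{Re}\langle e_\alpha\cdot\psi^i,\psi^m\rangle+\phi^i_\alpha\phi^m-\phi^i\phi^m_\alpha$$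 is smooth and divergence free, i.e. $\operatorname{div}J^{im}=\sum_\alpha h(\nabla_{e_\alpha}J^{im},e_\alpha)=0$ on $M$. -/

import Mathlib

open Bundle Manifold Module
open scoped ContDiff

noncomputable section

namespace KappaDirac

section Sections

variable {E : Type*} [NormedAddCommGroup E] [NormedSpace ℝ E]
  {H : Type*} [TopologicalSpace H] (I : ModelWithCorners ℝ E H)
  {M : Type*} [TopologicalSpace M] [ChartedSpace H M]
  (F : Type*) [NormedAddCommGroup F] [NormedSpace ℝ F]
  {V : M → Type*} [TopologicalSpace (TotalSpace F V)] [∀ x, TopologicalSpace (V x)]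
  [FiberBundle F V]

/-- The section `σ` of `V` is smooth at `x`. -/
abbrev SmoothAt (σ : Π x : M, V x) (x : M) : Prop :=
  ContMDiffAt I (I.prod 𝓘(ℝ, F)) ∞ (fun y ↦ TotalSpace.mk' F y (σ y)) x

/-- The section `σ` of `V` is differentiable at `x`. -/
abbrev DiffAt (σ : Π x : M, V x) (x : M) : Prop :=
  MDifferentiableAt I (I.prod 𝓘(ℝ, F)) (fun y ↦ TotalSpace.mk' F y (σ y)) x

end Sections

section Riemannian

variable {E : Type*} [NormedAddCommGroup E] [NormedSpace ℝ E] [FiniteDimensional ℝ E]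
  {H : Type*} [TopologicalSpace H] {I : ModelWithCorners ℝ E H}
  {M : Type*} [TopologicalSpace M] [ChartedSpace H M] [IsManifold I ∞ M]

instance instFiniteDimensionalTangentSpace (x : M) : FiniteDimensional ℝ (TangentSpace I x) :=
  inferInstanceAs (FiniteDimensional ℝ E)

/-- The Levi-Civita connection of the Riemannian metric: the metric, torsion-free connection on
the tangent bundle. -/
structure IsLeviCivita [RiemannianBundle (fun x : M ↦ TangentSpace I x)]
    (nabla : CovariantDerivative I E (fun x : M ↦ TangentSpace I x)) : Prop where
  /-- `v (h (X, Y)) = h (∇_v X, Y) + h (X, ∇_v Y)`. -/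
  metric (X Y : Π x : M, TangentSpace I x) (x : M)
    (hX : DiffAt I E X x) (hY : DiffAt I E Y x) (v : TangentSpace I x) :
    mvfderiv I (fun y ↦ inner ℝ (X y) (Y y)) x v =
      inner ℝ (nabla X x v) (Y x) + inner ℝ (X x) (nabla Y x v)
  torsion_free : nabla.torsion = 0

/-- The divergence of a vector field, the trace of `v ↦ ∇_v X`. In an orthonormal basis this is
`∑ α, h (∇_{e α} X, e α)`. -/
def divergence (nabla : CovariantDerivative I E (fun x : M ↦ TangentSpace I x))
    (X : Π x : M, TangentSpace I x) (x : M) : ℝ :=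
  LinearMap.trace ℝ (TangentSpace I x) (nabla X x : TangentSpace I x →ₗ[ℝ] TangentSpace I x)

variable [RiemannianBundle (fun x : M ↦ TangentSpace I x)]

variable (I) in
/-- An orthonormal basis `e α` of the tangent space at `x`. All the expressions below in which it
appears are contractions that do not depend on the choice of the basis. -/
def frame (x : M) :
    OrthonormalBasis (Fin (finrank ℝ (TangentSpace I x))) ℝ (TangentSpace I x) :=
  stdOrthonormalBasis ℝ (TangentSpace I x)

variable (I) in
/-- The vector field `∑ α, θ (e α) e α` that is metrically dual to a one-form `θ`. -/
def sharp (θ : Π x : M, TangentSpace I x →ₗ[ℝ] ℝ) (x : M) : TangentSpace I x :=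
  ∑ α, θ x (frame I x α) • frame I x α

/-- The Laplace-Beltrami operator `Δ f = div (grad f)` (a non-positive operator). -/
def laplacian (nabla : CovariantDerivative I E (fun x : M ↦ TangentSpace I x))
    (f : M → ℝ) (x : M) : ℝ :=
  divergence nabla (sharp I fun y ↦ (mvfderiv I f y : TangentSpace I y →ₗ[ℝ] ℝ)) x

end Riemannian

section Spinors

variable {E : Type*} [NormedAddCommGroup E] [NormedSpace ℝ E] [FiniteDimensional ℝ E]
  {H : Type*} [TopologicalSpace H] {I : ModelWithCorners ℝ E H}
  {M : Type*} [TopologicalSpace M] [ChartedSpace H M] [IsManifold I ∞ M]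
  [RiemannianBundle (fun x : M ↦ TangentSpace I x)]
  {F : Type*} [NormedAddCommGroup F] [NormedSpace ℂ F] [FiniteDimensional ℂ F]
  {S : M → Type*} [TopologicalSpace (TotalSpace F S)]
  [∀ x, NormedAddCommGroup (S x)] [∀ x, InnerProductSpace ℂ (S x)]
  [FiberBundle F S] [VectorBundle ℝ F S]
  [ContMDiffVectorBundle ∞ F S I]

variable (F S) in
/-- A Dirac bundle: a hermitian vector bundle `S` with a smooth, skew-hermitian Clifford
multiplication by tangent vectors and a smooth hermitian connection, which is compatible with
Clifford multiplication and the connection `nabla` of the tangent bundle. The spinor bundle of a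
Riemannian spin manifold, with the Levi-Civita connection `nabla` and the connection that it
induces on spinors, is of this kind. -/
structure DiracBundle
    (nabla : CovariantDerivative I E (fun x : M ↦ TangentSpace I x)) where
  /-- Clifford multiplication `X · ψ`. -/
  clifford (x : M) : TangentSpace I x →ₗ[ℝ] S x →ₗ[ℂ] S x
  /-- The connection on spinors. -/
  conn : CovariantDerivative I F S
  /-- The hermitian metric is smooth. -/
  inner_smooth (ψ η : Π x, S x) (x : M) (hψ : SmoothAt I F ψ x) (hη : SmoothAt I F η x) :
    ContMDiffAt I 𝓘(ℝ, ℂ) ∞ (fun y ↦ inner ℂ (ψ y) (η y)) x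
  /-- `⟨ψ, X · η⟩ = - ⟨X · ψ, η⟩`. -/
  clifford_skew (x : M) (X : TangentSpace I x) (ψ η : S x) :
    inner ℂ ψ (clifford x X η) = -inner ℂ (clifford x X ψ) η
  /-- `X · Y · ψ + Y · X · ψ = -2 h (X, Y) ψ`. -/
  clifford_relation (x : M) (X Y : TangentSpace I x) (ψ : S x) :
    clifford x X (clifford x Y ψ) + clifford x Y (clifford x X ψ) = (-2 * inner ℝ X Y : ℝ) • ψ
  /-- Clifford multiplication is smooth. -/
  clifford_smooth (X : Π x : M, TangentSpace I x) (ψ : Π x, S x) (x : M)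
    (hX : SmoothAt I E X x) (hψ : SmoothAt I F ψ x) :
    SmoothAt I F (fun y ↦ clifford y (X y) (ψ y)) x
  /-- The connection is smooth. -/
  conn_smooth : CovariantDerivative.ContMDiffCovariantDerivative conn ∞
  /-- The connection is complex linear. -/
  conn_smul (a : ℂ) (ψ : Π x, S x) (x : M) (hψ : DiffAt I F ψ x) (v : TangentSpace I x) :
    conn (fun y ↦ a • ψ y) x v = a • conn ψ x v
  /-- `v ⟨ψ, η⟩ = ⟨∇_v ψ, η⟩ + ⟨ψ, ∇_v η⟩`. -/
  conn_metric (ψ η : Π x, S x) (x : M)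
    (hψ : DiffAt I F ψ x) (hη : DiffAt I F η x) (v : TangentSpace I x) :
    mvfderiv I (fun y ↦ inner ℂ (ψ y) (η y)) x v =
      inner ℂ (conn ψ x v) (η x) + inner ℂ (ψ x) (conn η x v)
  /-- `∇_v (X · ψ) = (∇_v X) · ψ + X · ∇_v ψ`. -/
  conn_clifford (X : Π x : M, TangentSpace I x) (ψ : Π x, S x) (x : M)
    (hX : DiffAt I E X x) (hψ : DiffAt I F ψ x) (v : TangentSpace I x) :
    conn (fun y ↦ clifford y (X y) (ψ y)) x v =
      clifford x (nabla X x v) (ψ x) + clifford x (X x) (conn ψ x v)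

variable {nabla : CovariantDerivative I E (fun x : M ↦ TangentSpace I x)}

/-- The Dirac operator `∑ α, e α · ∇_{e α} ψ`. -/
def dirac (D : DiracBundle F S nabla) (ψ : Π x, S x) (x : M) : S x :=
  ∑ α, D.clifford x (frame I x α) (D.conn ψ x (frame I x α))

/-- The `i`-th component of a map into the unit sphere of `ℝ^(n+1)`. -/
def comp {n : ℕ} (φ : M → Metric.sphere (0 : EuclideanSpace ℝ (Fin (n + 1))) 1)
    (i : Fin (n + 1)) (x : M) : ℝ :=
  (φ x : EuclideanSpace ℝ (Fin (n + 1))) i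

/-- A smooth `κ`-Dirac-harmonic map `(φ, ψ)` into the unit sphere `S^n ⊂ ℝ^(n+1)`. The vector
spinor `ψ`, a section of `S ⊗ φ^* T S^n ⊂ S ⊗ ℝ^(n+1)`, is given by its components
`ψ 0, …, ψ n`, which are sections of `S`. -/
structure IsKappaDiracHarmonic {n : ℕ} (D : DiracBundle F S nabla) (κ : ℝ)
    (φ : M → Metric.sphere (0 : EuclideanSpace ℝ (Fin (n + 1))) 1)
    (ψ : Fin (n + 1) → Π x, S x) : Prop where
  smooth_map : ContMDiff I (𝓡 n) ∞ φ
  smooth_spinor (i : Fin (n + 1)) (x : M) : SmoothAt I F (ψ i) x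
  /-- `ψ` takes values in `S ⊗ φ^* T S^n`. -/
  tangent (x : M) : ∑ i, comp φ i x • ψ i x = 0
  /-- `-Δ φ^i = |dφ|² φ^i + Re ⟨ψ^i, e_α · ψ^j⟩ φ^j_α`. -/
  map_eq (i : Fin (n + 1)) (x : M) :
    -laplacian nabla (comp φ i) x =
      (∑ α, ∑ j, mvfderiv I (comp φ j) x (frame I x α) ^ 2) * comp φ i x +
      ∑ α, ∑ j, (inner ℂ (ψ i x) (D.clifford x (frame I x α) (ψ j x))).re *
        mvfderiv I (comp φ j) x (frame I x α)
  /-- `∂̸ ψ^i = -φ^j_α φ^i e_α · ψ^j - 2 κ (|ψ|² ψ^i - ⟨ψ^j, ψ^i⟩ ψ^j)`. -/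
  spinor_eq (i : Fin (n + 1)) (x : M) :
    dirac D (ψ i) x =
      -(∑ α, ∑ j, (mvfderiv I (comp φ j) x (frame I x α) * comp φ i x) •
          D.clifford x (frame I x α) (ψ j x)) -
      (2 * κ) • ((∑ j, ‖ψ j x‖ ^ 2) • ψ i x - ∑ j, inner ℂ (ψ j x) (ψ i x) • ψ j x)

/-- The one-form `v ↦ Re ⟨v · ψ^i, ψ^m⟩ + dφ^i(v) φ^m - φ^i dφ^m(v)`, whose value at `e α` is
the component `J_α^{im}`. -/
def currentForm {n : ℕ} (D : DiracBundle F S nabla)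
    (φ : M → Metric.sphere (0 : EuclideanSpace ℝ (Fin (n + 1))) 1)
    (ψ : Fin (n + 1) → Π x, S x) (i m : Fin (n + 1)) (x : M) : TangentSpace I x →ₗ[ℝ] ℝ where
  toFun v := (inner ℂ (D.clifford x v (ψ i x)) (ψ m x)).re +
    (mvfderiv I (comp φ i) x v * comp φ m x - comp φ i x * mvfderiv I (comp φ m) x v)
  map_add' v w := by
    simp only [map_add, LinearMap.add_apply, inner_add_left, Complex.add_re]
    ring
  map_smul' a v := by
    have h : inner ℂ (a • D.clifford x v (ψ i x)) (ψ m x) =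
        (a : ℂ) * inner ℂ (D.clifford x v (ψ i x)) (ψ m x) := by
      rw [← Complex.coe_smul, inner_smul_left, Complex.conj_ofReal]
    simp only [map_smul, LinearMap.smul_apply, h, Complex.re_ofReal_mul, smul_eq_mul,
      RingHom.id_apply]
    ring

/-- The Noether current, the vector field `J^{im} = ∑ α, J_α^{im} e α`. -/
def noetherCurrent {n : ℕ} (D : DiracBundle F S nabla)
    (φ : M → Metric.sphere (0 : EuclideanSpace ℝ (Fin (n + 1))) 1)
    (ψ : Fin (n + 1) → Π x, S x) (i m : Fin (n + 1)) : Π x : M, TangentSpace I x :=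
  sharp I (currentForm D φ ψ i m)

end Spinors

end KappaDirac

end

/-!
Let `χ = ∑ j, grad φ^j · ψ^j`. The equations read `-Δ φ^i = ρ φ^i + Re ⟨ψ^i, χ⟩` and
`D ψ^i = -φ^i χ - P^i`, with `ρ = |dφ|²` and `P^i` cubic in `ψ`. Since Clifford multiplication is
skew-hermitian and parallel, the spinorial part of `J^{im}` has divergence
`Re ⟨D ψ^i, ψ^m⟩ - Re ⟨ψ^i, D ψ^m⟩`; the other part is `φ^m grad φ^i - φ^i grad φ^m`, with
divergence `φ^m Δ φ^i - φ^i Δ φ^m`. In the sum the terms with `ρ` and `χ` cancel in pairs, and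
those with `P` cancel because `⟨P^i, ψ^m⟩ = ⟨ψ^i, P^m⟩`.
-/

namespace KappaDirac

open InnerProductSpace in
theorem sum_inner_div_smul_gramSchmidt {𝕜 ι V : Type*} [RCLike 𝕜] [LinearOrder ι]
    [LocallyFiniteOrderBot ι] [WellFoundedLT ι] [Fintype ι] [NormedAddCommGroup V]
    [InnerProductSpace 𝕜 V] (b : Basis ι 𝕜 V) (v : V) :
    ∑ i, (inner 𝕜 (gramSchmidt 𝕜 b i) v / inner 𝕜 (gramSchmidt 𝕜 b i) (gramSchmidt 𝕜 b i)) •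
      gramSchmidt 𝕜 b i = v := by
  refine InnerProductSpace.ext_inner_left_basis (𝕜 := 𝕜) (gramSchmidtBasis b) fun j ↦ ?_
  rw [coe_gramSchmidtBasis, inner_sum, Finset.sum_eq_single j]
  · rw [inner_smul_right,
      div_mul_cancel₀ _ (inner_self_ne_zero.2 (gramSchmidt_ne_zero j b.linearIndependent))]
  · intro i _ hij
    rw [inner_smul_right, gramSchmidt_orthogonal 𝕜 b hij.symm, mul_zero]
  · simp

section RiemannianVectorBundle

open InnerProductSpace

variable {E : Type*} [NormedAddCommGroup E] [NormedSpace ℝ E]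
  {H : Type*} [TopologicalSpace H] {I : ModelWithCorners ℝ E H} {k : ℕ∞ω}
  {M : Type*} [TopologicalSpace M] [ChartedSpace H M]
  {F : Type*} [NormedAddCommGroup F] [NormedSpace ℝ F]
  {V : M → Type*} [TopologicalSpace (TotalSpace F V)]
  [∀ x, NormedAddCommGroup (V x)] [∀ x, InnerProductSpace ℝ (V x)]
  [FiberBundle F V] [VectorBundle ℝ F V] [IsContMDiffRiemannianBundle I k F V] {x : M}

theorem contMDiffAt_gramSchmidt {ι : Type*} [LinearOrder ι] [LocallyFiniteOrderBot ι]
    [WellFoundedLT ι] {s : ι → Π x, V x} (hs : ∀ i, CMDiffAt k (T% (s i)) x)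
    (hli : LinearIndependent ℝ (s · x)) (i : ι) :
    CMDiffAt k (T% fun y ↦ gramSchmidt ℝ (s · y) i) x := by
  induction i using WellFoundedLT.induction with
  | ind i ih =>
    have hrec (y : M) : gramSchmidt ℝ (s · y) i = s i y - ∑ j ∈ Finset.Iio i,
        (inner ℝ (gramSchmidt ℝ (s · y) j) (s i y) /
          inner ℝ (gramSchmidt ℝ (s · y) j) (gramSchmidt ℝ (s · y) j)) •
            gramSchmidt ℝ (s · y) j := by
      simp only [real_inner_self_eq_norm_sq]
      exact eq_sub_of_add_eq (gramSchmidt_def'' ℝ (s · y) i).symm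
    simp only [hrec]
    refine (hs i).sub_section (ContMDiffAt.sum_section fun j hj ↦ ?_)
    have hgj := ih j (Finset.mem_Iio.1 hj)
    exact ((hgj.inner_bundle (hs i)).div₀ (hgj.inner_bundle hgj)
      (inner_self_ne_zero.2 (gramSchmidt_ne_zero j hli))).smul_section hgj

theorem contMDiffAt_section_of_inner [FiniteDimensional ℝ F] [ContMDiffVectorBundle k F V I]
    {σ : Π x, V x}
    (hσ : ∀ τ : Π x, V x, CMDiffAt k (T% τ) x → CMDiffAt k (fun y ↦ inner ℝ (τ y) (σ y)) x) :
    CMDiffAt k (T% σ) x := by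
  let e := trivializationAt F V x
  let s := e.localFrame (finBasis ℝ F)
  have hs : IsLocalFrameOn I F k s e.baseSet := e.isLocalFrameOn_localFrame_baseSet I k _
  have hx : x ∈ e.baseSet := FiberBundle.mem_baseSet_trivializationAt' x
  let g (i) (y : M) := gramSchmidt ℝ (s · y) i
  have hg (i) : CMDiffAt k (T% (g i)) x :=
    contMDiffAt_gramSchmidt (hs.contMDiffAt e.open_baseSet hx) (hs.linearIndependent hx) i
  have hg₀ (i) : g i x ≠ 0 := gramSchmidt_ne_zero i (hs.linearIndependent hx)
  have hsum : CMDiffAt k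
      (T% fun y ↦ ∑ i, (inner ℝ (g i y) (σ y) / inner ℝ (g i y) (g i y)) • g i y) x :=
    ContMDiffAt.sum_section fun i _ ↦ ((hσ _ (hg i)).div₀ ((hg i).inner_bundle (hg i))
      (inner_self_ne_zero.2 (hg₀ i))).smul_section (hg i)
  refine hsum.congr_of_eventuallyEq ?_
  filter_upwards [e.open_baseSet.mem_nhds hx] with y hy
  have hcoe : (hs.toBasisAt hy : _ → V y) = (s · y) := funext (hs.toBasisAt_coe hy)
  have hexpand := sum_inner_div_smul_gramSchmidt (hs.toBasisAt hy) (σ y)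
  rw [hcoe] at hexpand
  exact congrArg (TotalSpace.mk' F y) hexpand.symm

end RiemannianVectorBundle

section VectorFields

variable {E : Type*} [NormedAddCommGroup E] [NormedSpace ℝ E]
  {H : Type*} [TopologicalSpace H] {I : ModelWithCorners ℝ E H}
  {M : Type*} [TopologicalSpace M] [ChartedSpace H M] {f g : M → ℝ} {x : M}

theorem contMDiffAt_mvfderiv_apply {G : Type*} [NormedAddCommGroup G] [NormedSpace ℝ G]
    {k l : ℕ∞ω} [IsManifold I 1 M] {f : M → G} {X : Π x : M, TangentSpace I x}
    (hf : CMDiffAt k f x) (hX : CMDiffAt l (T% X) x) (hlk : l + 1 ≤ k) :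
    CMDiffAt l (fun y ↦ mvfderiv I f y (X y)) x := by
  have h := ContMDiffAt.clm_apply_of_inCoordinates (hf.mfderiv_const hlk) hX
    (hf.of_le (le_self_add.trans hlk))
  rw [contMDiffAt_totalSpace] at h
  simpa using! h.2

theorem mvfderiv_continuousLinearMap_comp {G G' : Type*} [NormedAddCommGroup G]
    [NormedSpace ℝ G] [NormedAddCommGroup G'] [NormedSpace ℝ G'] (L : G →L[ℝ] G') {f : M → G}
    (hf : MDifferentiableAt I 𝓘(ℝ, G) f x) (v : TangentSpace I x) :
    mvfderiv I (fun y ↦ L (f y)) x v = L (mvfderiv I f x v) := by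
  have h := mfderiv_comp_apply x L.differentiableAt.mdifferentiableAt hf v
  rwa [mfderiv_eq_fderiv, L.fderiv] at h

section Divergence

variable [IsManifold I ∞ M] {nabla : CovariantDerivative I E (fun x : M ↦ TangentSpace I x)}
  {X Y : Π x : M, TangentSpace I x}

theorem divergence_add (hX : DiffAt I E X x) (hY : DiffAt I E Y x) :
    divergence nabla (X + Y) x = divergence nabla X x + divergence nabla Y x := by
  rw [divergence, nabla.isCovariantDerivativeOnUniv.add hX hY]
  exact map_add (LinearMap.trace ℝ (TangentSpace I x)) _ _

theorem divergence_neg (hX : DiffAt I E X x) :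
    divergence nabla (-X) x = -divergence nabla X x := by
  rw [← neg_one_smul ℝ X, divergence, nabla.isCovariantDerivativeOnUniv.smul_const _ hX,
    neg_one_smul]
  exact map_neg (LinearMap.trace ℝ (TangentSpace I x)) _

theorem divergence_sub (hX : DiffAt I E X x) (hY : DiffAt I E Y x) :
    divergence nabla (X - Y) x = divergence nabla X x - divergence nabla Y x := by
  rw [sub_eq_add_neg, divergence_add hX (mdifferentiableAt_neg_section hY), divergence_neg hY,
    sub_eq_add_neg]

variable [FiniteDimensional ℝ E]

theorem divergence_smul (hf : MDiffAt f x) (hX : DiffAt I E X x) :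
    divergence nabla (f • X) x = f x * divergence nabla X x + mvfderiv I f x (X x) := by
  rw [divergence, nabla.isCovariantDerivativeOnUniv.leibniz hX hf]
  calc LinearMap.trace ℝ (TangentSpace I x)
        (f x • (nabla X x : TangentSpace I x →ₗ[ℝ] TangentSpace I x) +
          (mvfderiv I f x : TangentSpace I x →ₗ[ℝ] ℝ).smulRight (X x))
      = f x * divergence nabla X x + mvfderiv I f x (X x) := by
        rw [map_add, map_smul, LinearMap.trace_smulRight]
        rfl

theorem divergence_eq_sum_inner [RiemannianBundle (fun x : M ↦ TangentSpace I x)] :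
    divergence nabla X x = ∑ α, inner ℝ (nabla X x (frame I x α)) (frame I x α) := by
  rw [divergence, LinearMap.trace_eq_sum_inner _ (frame I x)]
  exact Finset.sum_congr rfl fun α _ ↦ real_inner_comm _ _

end Divergence

variable [FiniteDimensional ℝ E] [RiemannianBundle (fun x : M ↦ TangentSpace I x)]
  {θ : Π x : M, TangentSpace I x →ₗ[ℝ] ℝ}

theorem inner_sharp (θ : Π x : M, TangentSpace I x →ₗ[ℝ] ℝ) (x : M) (v : TangentSpace I x) :
    inner ℝ (sharp I θ x) v = θ x v := by
  calc inner ℝ (sharp I θ x) v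
      = θ x (∑ α, inner ℝ (frame I x α) v • frame I x α) := by
        simp only [sharp, sum_inner, real_inner_smul_left, map_sum, map_smul, smul_eq_mul,
          mul_comm]
    _ = θ x v := by rw [(frame I x).sum_repr']

variable (I) in
/-- The gradient of a function with respect to the Riemannian metric; `laplacian nabla f` is by
definition the divergence of `grad I f`. -/
noncomputable def grad (f : M → ℝ) : Π x : M, TangentSpace I x :=
  sharp I fun y ↦ (mvfderiv I f y : TangentSpace I y →ₗ[ℝ] ℝ)

theorem inner_grad (f : M → ℝ) (x : M) (v : TangentSpace I x) :
    inner ℝ (grad I f x) v = mvfderiv I f x v :=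
  inner_sharp _ x v

theorem mvfderiv_grad_comm : mvfderiv I f x (grad I g x) = mvfderiv I g x (grad I f x) := by
  rw [← inner_grad, ← inner_grad, real_inner_comm]

variable [IsManifold I ∞ M] {nabla : CovariantDerivative I E (fun x : M ↦ TangentSpace I x)}

theorem divergence_smul_grad (hg : MDiffAt g x) (hf : DiffAt I E (grad I f) x) :
    divergence nabla (g • grad I f) x =
      g x * laplacian nabla f x + mvfderiv I g x (grad I f x) :=
  divergence_smul hg hf

theorem divergence_smul_grad_sub (hf : MDiffAt f x) (hg : MDiffAt g x)
    (hf' : DiffAt I E (grad I f) x) (hg' : DiffAt I E (grad I g) x) :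
    divergence nabla (g • grad I f - f • grad I g) x =
      g x * laplacian nabla f x - f x * laplacian nabla g x := by
  rw [divergence_sub (hg.smul_section hf') (hf.smul_section hg'), divergence_smul_grad hg hf',
    divergence_smul_grad hf hg', mvfderiv_grad_comm]
  ring

/-- Compatibility of a connection on the tangent bundle with the Riemannian metric: a Levi-Civita
connection up to torsion. -/
def IsMetric (nabla : CovariantDerivative I E (fun x : M ↦ TangentSpace I x)) : Prop :=
  ∀ (X Y : Π x : M, TangentSpace I x) (x : M), DiffAt I E X x → DiffAt I E Y x →
    ∀ v : TangentSpace I x, mvfderiv I (fun y ↦ inner ℝ (X y) (Y y)) x v =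
      inner ℝ (nabla X x v) (Y x) + inner ℝ (X x) (nabla Y x v)

theorem IsLeviCivita.isMetric (hnabla : IsLeviCivita nabla) : IsMetric nabla :=
  hnabla.metric

theorem inner_nabla_sharp (hnabla : IsMetric nabla) {X : Π x : M, TangentSpace I x}
    (hθ : DiffAt I E (sharp I θ) x) (hX : DiffAt I E X x) (v : TangentSpace I x) :
    inner ℝ (nabla (sharp I θ) x v) (X x) =
      mvfderiv I (fun y ↦ θ y (X y)) x v - θ x (nabla X x v) := by
  have h := hnabla _ X x hθ hX v
  simp only [inner_sharp] at h
  exact eq_sub_of_add_eq h.symm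

variable [IsContMDiffRiemannianBundle I ∞ E (fun x : M ↦ TangentSpace I x)]

theorem smoothAt_sharp
    (hθ : ∀ X : Π x : M, TangentSpace I x, SmoothAt I E X x →
      CMDiffAt ∞ (fun y ↦ θ y (X y)) x) :
    SmoothAt I E (sharp I θ) x := by
  refine contMDiffAt_section_of_inner (V := fun x : M ↦ TangentSpace I x) fun X hX ↦
    (hθ X hX).congr_of_eventuallyEq (.of_forall fun y ↦ ?_)
  exact (real_inner_comm _ _).trans (inner_sharp θ y (X y))

theorem smoothAt_grad (hf : CMDiffAt ∞ f x) : SmoothAt I E (grad I f) x :=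
  smoothAt_sharp fun _ hX ↦ contMDiffAt_mvfderiv_apply hf hX (by simp)

end VectorFields

section Spinors

variable {V ι : Type*} [NormedAddCommGroup V] [InnerProductSpace ℂ V] [Fintype ι]

/-- The potential term `|ψ|² ψ^i - ∑ j, ⟨ψ^j, ψ^i⟩ ψ^j` of the Dirac equation, for a vector spinor
with components `ψ i`. -/
noncomputable def cubicTerm (ψ : ι → V) (i : ι) : V :=
  (∑ j, ‖ψ j‖ ^ 2) • ψ i - ∑ j, inner ℂ (ψ j) (ψ i) • ψ j

theorem inner_cubicTerm_left (ψ : ι → V) (i m : ι) :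
    inner ℂ (cubicTerm ψ i) (ψ m) = inner ℂ (ψ i) (cubicTerm ψ m) := by
  simp only [cubicTerm, inner_sub_left, inner_sub_right, sum_inner, inner_sum, inner_smul_left,
    inner_smul_right, inner_conj_symm, inner_smul_left_eq_smul, inner_smul_right_eq_smul, mul_comm]

variable {E : Type*} [NormedAddCommGroup E] [NormedSpace ℝ E]
  {H : Type*} [TopologicalSpace H] {I : ModelWithCorners ℝ E H}
  {M : Type*} [TopologicalSpace M] [ChartedSpace H M] [IsManifold I ∞ M]
  [RiemannianBundle (fun x : M ↦ TangentSpace I x)]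
  {F : Type*} [NormedAddCommGroup F] [NormedSpace ℂ F]
  {S : M → Type*} [TopologicalSpace (TotalSpace F S)]
  [∀ x, NormedAddCommGroup (S x)] [∀ x, InnerProductSpace ℂ (S x)]
  [FiberBundle F S] [VectorBundle ℝ F S]
  {nabla : CovariantDerivative I E (fun x : M ↦ TangentSpace I x)}
  (D : DiracBundle F S nabla) {x : M}

/-- The one-form `v ↦ Re ⟨v · ψ, η⟩`, whose dual vector field is the spinorial part of the Noether
current. -/
noncomputable def spinorForm (ψ η : Π x, S x) (x : M) : TangentSpace I x →ₗ[ℝ] ℝ where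
  toFun v := (inner ℂ (D.clifford x v (ψ x)) (η x)).re
  map_add' v w := by simp only [map_add, LinearMap.add_apply, inner_add_left, Complex.add_re]
  map_smul' a v := by
    rw [map_smul, LinearMap.smul_apply, inner_smul_left_eq_smul, Complex.smul_re, RingHom.id_apply]

theorem spinorForm_apply (ψ η : Π x, S x) (x : M) (v : TangentSpace I x) :
    spinorForm D ψ η x v = (inner ℂ (D.clifford x v (ψ x)) (η x)).re := rfl

variable {ψ η : Π x, S x} {X : Π x : M, TangentSpace I x}

theorem contMDiffAt_spinorForm_apply (hψ : SmoothAt I F ψ x) (hη : SmoothAt I F η x)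
    (hX : SmoothAt I E X x) : CMDiffAt ∞ (fun y ↦ spinorForm D ψ η y (X y)) x :=
  Complex.reCLM.contMDiff.contMDiffAt.comp x
    (D.inner_smooth _ _ x (D.clifford_smooth X ψ x hX hψ) hη)

theorem mvfderiv_spinorForm_apply (hψ : SmoothAt I F ψ x) (hη : SmoothAt I F η x)
    (hX : SmoothAt I E X x) (v : TangentSpace I x) :
    mvfderiv I (fun y ↦ spinorForm D ψ η y (X y)) x v =
      spinorForm D ψ η x (nabla X x v) +
        (inner ℂ (D.clifford x (X x) (D.conn ψ x v)) (η x)).re +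
        (inner ℂ (D.clifford x (X x) (ψ x)) (D.conn η x v)).re := by
  have hXψ := D.clifford_smooth X ψ x hX hψ
  have hdiff : MDifferentiableAt I 𝓘(ℝ, ℂ)
      (fun y ↦ inner ℂ (D.clifford y (X y) (ψ y)) (η y)) x :=
    (D.inner_smooth _ _ x hXψ hη).mdifferentiableAt (by simp)
  simp only [spinorForm_apply, ← Complex.reCLM_apply]
  rw [mvfderiv_continuousLinearMap_comp Complex.reCLM hdiff,
    D.conn_metric _ _ x (hXψ.mdifferentiableAt (by simp)) (hη.mdifferentiableAt (by simp)),
    D.conn_clifford X ψ x (hX.mdifferentiableAt (by simp)) (hψ.mdifferentiableAt (by simp)),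
    inner_add_left, map_add, map_add]

variable [FiniteDimensional ℝ E]

/-- The contraction `∑ j, grad f^j · ψ^j`, through which the map and the spinor interact in the
Dirac-harmonic equations. -/
noncomputable def couplingSpinor (f : ι → M → ℝ) (ψ : ι → Π x, S x) (x : M) : S x :=
  ∑ j, D.clifford x (grad I (f j) x) (ψ j x)

theorem couplingSpinor_eq_sum_frame (f : ι → M → ℝ) (ψ : ι → Π x, S x) (x : M) :
    couplingSpinor D f ψ x =
      ∑ α, ∑ j, mvfderiv I (f j) x (frame I x α) • D.clifford x (frame I x α) (ψ j x) := by
  rw [Finset.sum_comm]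
  simp only [couplingSpinor, grad, sharp, map_sum, map_smul, LinearMap.sum_apply,
    LinearMap.smul_apply, ContinuousLinearMap.coe_coe]

theorem re_inner_couplingSpinor (f : ι → M → ℝ) (ψ : ι → Π x, S x) (ξ : S x) :
    (inner ℂ ξ (couplingSpinor D f ψ x)).re =
      ∑ α, ∑ j, (inner ℂ ξ (D.clifford x (frame I x α) (ψ j x))).re *
        mvfderiv I (f j) x (frame I x α) := by
  simp only [couplingSpinor_eq_sum_frame, inner_sum, Complex.re_sum, inner_smul_right_eq_smul,
    Complex.smul_re, smul_eq_mul, mul_comm]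

theorem smul_couplingSpinor (f : ι → M → ℝ) (ψ : ι → Π x, S x) (a : ℝ) :
    a • couplingSpinor D f ψ x = ∑ α, ∑ j, (mvfderiv I (f j) x (frame I x α) * a) •
      D.clifford x (frame I x α) (ψ j x) := by
  simp only [couplingSpinor_eq_sum_frame, Finset.smul_sum, smul_smul, mul_comm]

/-- The vector field dual to `v ↦ Re ⟨v · ψ, η⟩ + df(v) g - f dg(v)`. It is the Noether current
`J^{im}` for `f = φ^i`, `g = φ^m`, `ψ = ψ^i` and `η = ψ^m`. -/
noncomputable def noetherField (f g : M → ℝ) (ψ η : Π x, S x) : Π x : M, TangentSpace I x :=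
  sharp I (spinorForm D ψ η) + (g • grad I f - f • grad I g)

theorem noetherCurrent_eq_noetherField {n : ℕ}
    (φ : M → Metric.sphere (0 : EuclideanSpace ℝ (Fin (n + 1))) 1)
    (ψ : Fin (n + 1) → Π x, S x) (i m : Fin (n + 1)) :
    noetherCurrent D φ ψ i m = noetherField D (comp φ i) (comp φ m) (ψ i) (ψ m) := by
  funext x
  refine ext_inner_right ℝ fun v ↦ ?_
  calc inner ℝ (noetherCurrent D φ ψ i m x) v = currentForm D φ ψ i m x v := inner_sharp _ x v
    _ = spinorForm D (ψ i) (ψ m) x v + (comp φ m x * mvfderiv I (comp φ i) x v -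
          comp φ i x * mvfderiv I (comp φ m) x v) := by
      rw [mul_comm (comp φ m x)]
      rfl
    _ = inner ℝ (noetherField D (comp φ i) (comp φ m) (ψ i) (ψ m) x) v := by
      simp only [noetherField, Pi.add_apply, Pi.sub_apply, Pi.smul_apply', inner_add_left,
        inner_sub_left, real_inner_smul_left, inner_sharp, inner_grad]

variable [IsContMDiffRiemannianBundle I ∞ E (fun x : M ↦ TangentSpace I x)]

theorem smoothAt_sharp_spinorForm (hψ : SmoothAt I F ψ x) (hη : SmoothAt I F η x) :
    SmoothAt I E (sharp I (spinorForm D ψ η)) x :=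
  smoothAt_sharp fun _ hX ↦ contMDiffAt_spinorForm_apply D hψ hη hX

theorem divergence_sharp_spinorForm (hnabla : IsMetric nabla) (hψ : SmoothAt I F ψ x)
    (hη : SmoothAt I F η x) :
    divergence nabla (sharp I (spinorForm D ψ η)) x =
      (inner ℂ (dirac D ψ x) (η x)).re - (inner ℂ (ψ x) (dirac D η x)).re := by
  rw [divergence_eq_sum_inner, dirac, dirac, sum_inner, inner_sum, Complex.re_sum, Complex.re_sum,
    ← Finset.sum_sub_distrib]
  refine Finset.sum_congr rfl fun α _ ↦ ?_
  set v := frame I x α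
  have hX : SmoothAt I E (FiberBundle.extend E v) x := FiberBundle.contMDiffAt_extend ..
  have h := inner_nabla_sharp hnabla
    ((smoothAt_sharp_spinorForm D hψ hη).mdifferentiableAt (by simp))
    (hX.mdifferentiableAt (by simp)) v
  rw [mvfderiv_spinorForm_apply D hψ hη hX, FiberBundle.extend_apply_self] at h
  rw [h, D.clifford_skew, Complex.neg_re]
  ring

variable {f g : M → ℝ}

theorem smoothAt_noetherField (hf : CMDiffAt ∞ f x) (hg : CMDiffAt ∞ g x)
    (hψ : SmoothAt I F ψ x) (hη : SmoothAt I F η x) :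
    SmoothAt I E (noetherField D f g ψ η) x :=
  (smoothAt_sharp_spinorForm D hψ hη).add_section
    ((hg.smul_section (smoothAt_grad hf)).sub_section (hf.smul_section (smoothAt_grad hg)))

theorem divergence_noetherField (hnabla : IsMetric nabla) (hf : CMDiffAt ∞ f x)
    (hg : CMDiffAt ∞ g x) (hψ : SmoothAt I F ψ x) (hη : SmoothAt I F η x) :
    divergence nabla (noetherField D f g ψ η) x =
      (inner ℂ (dirac D ψ x) (η x)).re - (inner ℂ (ψ x) (dirac D η x)).re +
        (g x * laplacian nabla f x - f x * laplacian nabla g x) := by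
  have hf₁ : MDiffAt f x := hf.mdifferentiableAt (by simp)
  have hg₁ : MDiffAt g x := hg.mdifferentiableAt (by simp)
  have hf₂ : DiffAt I E (grad I f) x := (smoothAt_grad hf).mdifferentiableAt (by simp)
  have hg₂ : DiffAt I E (grad I g) x := (smoothAt_grad hg).mdifferentiableAt (by simp)
  rw [noetherField, divergence_add
    ((smoothAt_sharp_spinorForm D hψ hη).mdifferentiableAt (by simp))
    (mdifferentiableAt_sub_section (hg₁.smul_section hf₂) (hf₁.smul_section hg₂)),
    divergence_sharp_spinorForm D hnabla hψ hη, divergence_smul_grad_sub hf₁ hg₁ hf₂ hg₂]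

theorem divergence_noetherField_eq_zero (hnabla : IsMetric nabla) (hf : CMDiffAt ∞ f x)
    (hg : CMDiffAt ∞ g x) (hψ : SmoothAt I F ψ x) (hη : SmoothAt I F η x)
    {ρ : ℝ} {χ P Q : S x}
    (hΔf : -laplacian nabla f x = ρ * f x + (inner ℂ (ψ x) χ).re)
    (hΔg : -laplacian nabla g x = ρ * g x + (inner ℂ (η x) χ).re)
    (hDψ : dirac D ψ x = -(f x • χ) - P) (hDη : dirac D η x = -(g x • χ) - Q)
    (hPQ : (inner ℂ P (η x)).re = (inner ℂ (ψ x) Q).re) :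
    divergence nabla (noetherField D f g ψ η) x = 0 := by
  have hχη : (inner ℂ χ (η x)).re = (inner ℂ (η x) χ).re :=
    inner_re_symm (𝕜 := ℂ) χ (η x)
  rw [divergence_noetherField D hnabla hf hg hψ hη, hDψ, hDη]
  simp only [inner_sub_left, inner_sub_right, inner_neg_left, inner_neg_right,
    inner_smul_left_eq_smul, inner_smul_right_eq_smul, Complex.sub_re, Complex.neg_re,
    Complex.smul_re, smul_eq_mul]
  linear_combination f x * hΔg - g x * hΔf - f x * hχη - hPQ

end Spinors

section Sphere

variable {E : Type*} [NormedAddCommGroup E] [NormedSpace ℝ E]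
  {H : Type*} [TopologicalSpace H] {I : ModelWithCorners ℝ E H}
  {M : Type*} [TopologicalSpace M] [ChartedSpace H M]

theorem contMDiff_comp {n : ℕ} {φ : M → Metric.sphere (0 : EuclideanSpace ℝ (Fin (n + 1))) 1}
    (hφ : ContMDiff I (𝓡 n) ∞ φ) (i : Fin (n + 1)) : CMDiff ∞ (comp φ i) := by
  have : Fact (finrank ℝ (EuclideanSpace ℝ (Fin (n + 1))) = n + 1) := ⟨finrank_euclideanSpace_fin⟩
  exact (EuclideanSpace.proj (𝕜 := ℝ) i).contMDiff.comp (contMDiff_coe_sphere.comp hφ)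

end Sphere

end KappaDirac

open KappaDirac in
theorem mainTheorem4_general
    {E : Type*} [NormedAddCommGroup E] [NormedSpace ℝ E] [FiniteDimensional ℝ E]
    {H : Type*} [TopologicalSpace H] {I : ModelWithCorners ℝ E H}
    {M : Type*} [TopologicalSpace M] [ChartedSpace H M] [IsManifold I ∞ M]
    [RiemannianBundle (fun x : M ↦ TangentSpace I x)]
    [IsContMDiffRiemannianBundle I ∞ E (fun x : M ↦ TangentSpace I x)]
    {nabla : CovariantDerivative I E (fun x : M ↦ TangentSpace I x)}
    (hnabla : IsMetric nabla)
    {F : Type*} [NormedAddCommGroup F] [NormedSpace ℂ F]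
    {S : M → Type*} [TopologicalSpace (TotalSpace F S)]
    [∀ x, NormedAddCommGroup (S x)] [∀ x, InnerProductSpace ℂ (S x)]
    [FiberBundle F S] [VectorBundle ℝ F S]
    (D : DiracBundle F S nabla) {κ : ℝ}
    {ι : Type*} [Fintype ι] {f : ι → M → ℝ} {ψ : ι → Π x, S x} {ρ : M → ℝ}
    (hf : ∀ i, CMDiff ∞ (f i)) (hψ : ∀ i x, SmoothAt I F (ψ i) x)
    (hmap : ∀ i x, -laplacian nabla (f i) x = ρ x * f i x +
      ∑ α, ∑ j, (inner ℂ (ψ i x) (D.clifford x (frame I x α) (ψ j x))).re *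
        mvfderiv I (f j) x (frame I x α))
    (hspinor : ∀ i x, dirac D (ψ i) x =
      -(∑ α, ∑ j, (mvfderiv I (f j) x (frame I x α) * f i x) •
          D.clifford x (frame I x α) (ψ j x)) -
      (2 * κ) • ((∑ j, ‖ψ j x‖ ^ 2) • ψ i x - ∑ j, inner ℂ (ψ j x) (ψ i x) • ψ j x))
    (i m : ι) :
    (∀ x, SmoothAt I E (noetherField D (f i) (f m) (ψ i) (ψ m)) x) ∧
      ∀ x, divergence nabla (noetherField D (f i) (f m) (ψ i) (ψ m)) x = 0 := by
  refine ⟨fun x ↦ smoothAt_noetherField D (hf i x) (hf m x) (hψ i x) (hψ m x), fun x ↦ ?_⟩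
  have hΔ (k : ι) : -laplacian nabla (f k) x =
      ρ x * f k x + (inner ℂ (ψ k x) (couplingSpinor D f ψ x)).re := by
    rw [hmap, re_inner_couplingSpinor]
  have hD (k : ι) : dirac D (ψ k) x = -(f k x • couplingSpinor D f ψ x) -
      (2 * κ) • cubicTerm (ψ · x) k := by
    rw [hspinor, smul_couplingSpinor, cubicTerm]
  refine divergence_noetherField_eq_zero D hnabla (hf i x) (hf m x) (hψ i x) (hψ m x)
    (hΔ i) (hΔ m) (hD i) (hD m) ?_
  rw [inner_smul_left_eq_smul, inner_smul_right_eq_smul, inner_cubicTerm_left (ψ · x)]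

theorem mainTheorem4 {d n : ℕ}
    {M : Type*} [TopologicalSpace M] [T2Space M] [CompactSpace M]
    [ChartedSpace (EuclideanSpace ℝ (Fin d)) M] [IsManifold (𝓡 d) ∞ M]
    [RiemannianBundle (fun x : M ↦ TangentSpace (𝓡 d) x)]
    [IsContMDiffRiemannianBundle (𝓡 d) ∞ (EuclideanSpace ℝ (Fin d))
      (fun x : M ↦ TangentSpace (𝓡 d) x)]
    (nabla : CovariantDerivative (𝓡 d) (EuclideanSpace ℝ (Fin d))
      (fun x : M ↦ TangentSpace (𝓡 d) x))
    (hnabla : KappaDirac.IsLeviCivita nabla)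
    {F : Type*} [NormedAddCommGroup F] [NormedSpace ℂ F] [FiniteDimensional ℂ F]
    {S : M → Type*} [TopologicalSpace (TotalSpace F S)]
    [∀ x, NormedAddCommGroup (S x)] [∀ x, InnerProductSpace ℂ (S x)]
    [FiberBundle F S] [VectorBundle ℂ F S] [VectorBundle ℝ F S]
    [ContMDiffVectorBundle ∞ F S (𝓡 d)]
    (D : KappaDirac.DiracBundle F S nabla) (κ : ℝ)
    (φ : M → Metric.sphere (0 : EuclideanSpace ℝ (Fin (n + 1))) 1)
    (ψ : Fin (n + 1) → Π x, S x)
    (h : KappaDirac.IsKappaDiracHarmonic D κ φ ψ) (i m : Fin (n + 1)) :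
    (∀ x, KappaDirac.SmoothAt (𝓡 d) (EuclideanSpace ℝ (Fin d))
        (KappaDirac.noetherCurrent D φ ψ i m) x) ∧
      ∀ x, KappaDirac.divergence nabla (KappaDirac.noetherCurrent D φ ψ i m) x = 0 := by
  rw [KappaDirac.noetherCurrent_eq_noetherField]
  exact mainTheorem4_general hnabla.isMetric D (KappaDirac.contMDiff_comp h.smooth_map)
    h.smooth_spinor h.map_eq h.spinor_eq i m
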